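/- Let $K$ be a finite extension of $\mathbb{Q}_2$ with algebraic closure $\bar K$, and let $E/K$ be an elliptic curve given by a Weierstrass equation with standard invariants $c_4, c_6, \Delta$. Let $L=K(E[3])\subset\bar K$ be the field generated over $K$ by the coordinates of the $3$-torsion points of $E$, let $G=\mathrm{Gal}(L/K)$, let $\mu_3\subset\bar K$ be the set of third roots of unity, and put $\gamma(x)=x^8-6c_4x^4-8c_6x^2-3c_4^2\in K[x]$. Suppose that $x^3-12^3\Delta$ has exactly one root $\delta$ in $K$ and that $\gamma(x)$ is irreducible over $K$. Then the following conditions are equivalent: 1. $G\cong C_8$, the cyclic group of order $8$; 2. $\gamma(x)$ is reducible over $K(\mu_3)$; 3. both $-3(c_4-\delta)$ and $-3(c_4^2+c_4\delta+\delta^2)$ are squares in $K$. Moreover, if $c_6\neq 0$, then $-3(c_4-\delta)$ is a square in $K$ if and only if $-3(c_4^2+c_4\delta+\delta^2)$ is a square in $K$. -/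

import Mathlib

open Polynomial

noncomputable section

open scoped Classical in
/-- The affine coordinates, in an algebraic closure of `K`, of the nonzero points `P` of `E` with
`m • P = 0`. -/
def torsionCoordinates {K : Type*} [Field K] (E : WeierstrassCurve K) (m : ℕ) :
    Set (AlgebraicClosure K) :=
  {t | ∃ (x y : AlgebraicClosure K)
      (h : (E.baseChange (AlgebraicClosure K)).toAffine.Nonsingular x y),
      m • (WeierstrassCurve.Affine.Point.some x y h) = 0 ∧ (t = x ∨ t = y)}

/-- The field `K(E[m])`, generated over `K` by the coordinates of the `m`-torsion points of `E`
over an algebraic closure of `K`. -/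
def torsionField {K : Type*} [Field K] (E : WeierstrassCurve K) (m : ℕ) :
    IntermediateField K (AlgebraicClosure K) :=
  IntermediateField.adjoin K (torsionCoordinates E m)

/-- The field `K(μ_m)`, generated over `K` by the `m`-th roots of unity in an algebraic closure. -/
def rootsOfUnityField (K : Type*) [Field K] (m : ℕ) :
    IntermediateField K (AlgebraicClosure K) :=
  IntermediateField.adjoin K {z : AlgebraicClosure K | z ^ m = 1}

/-- The polynomial `γ(x) = x^8 - 6 c₄ x^4 - 8 c₆ x^2 - 3 c₄^2`. -/
def gammaPoly {K : Type*} [Field K] (E : WeierstrassCurve K) : K[X] :=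
  X ^ 8 - C (6 * E.c₄) * X ^ 4 - C (8 * E.c₆) * X ^ 2 - C (3 * E.c₄ ^ 2)

end

/-! If `s` is the slope of the tangent at a nonzero 3-torsion point, then `l = 2s + a₁` is a root of
γ, and the point is recovered rationally from `l`. So `L` is the splitting field of γ
(`torsionField_three_eq_adjoin_rootSet`), and irreducibility makes `G` transitive on eight roots.
Ferrari's formulas give `l² = ±a ± b ± c` with an even number of minus signs and `abc = c₆`.
Uniqueness of `δ` forces `ω ∉ K`.

By `irreducible_map_iff`, γ is reducible over `K(μ₃)` exactly when every automorphism fixing a root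
fixes `ω`. This holds if `|G| = 8`, since a transitive action of eight elements on eight roots is
free. An automorphism moving `ω` swaps `b` and `c` up to sign. If it fixes `bc`, it fixes `a` and
also some root (`exists_fixed_root`); if it negates `a` and `bc`, its fourth power negates `l`
(`iterate_four`). Condition 2 rules out the first kind, so `√-3 a` and `√-3 bc` are Galois
invariant, which is condition 3. Conversely, condition 3 leaves only the second kind, giving an
element of order 8, and makes the stabilizer of a root trivial; hence `G ≅ C₈`. -/

/-! ### Flex tangents and the roots of γ -/

namespace WeierstrassCurve.Affine

variable {F : Type*} [Field F] [DecidableEq F]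

/-- A point is `3`-torsion exactly when its tangent line is a flex: the tangent meets the curve
only there. -/
lemma three_smul_some_eq_zero_iff {W : WeierstrassCurve.Affine F} {x y : F}
    (h : W.Nonsingular x y) :
    3 • Point.some x y h = 0 ↔
      y ≠ W.negY x y ∧ W.addX x x (W.slope x x y y) = x := by
  rw [show (3 : ℕ) = 2 + 1 from rfl, add_smul, one_smul, two_smul, add_eq_zero_iff_eq_neg]
  by_cases hy : y = W.negY x y
  · rw [Point.add_self_of_Y_eq hy]
    simp only [← hy, ne_eq, not_true_eq_false, false_and, iff_false]
    rw [eq_comm, neg_eq_zero]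
    exact Point.some_ne_zero h
  · rw [Point.add_self_of_Y_ne hy, Point.neg_some, Point.some.injEq]
    refine ⟨fun H => ⟨hy, H.1⟩, fun H => ⟨H.2, ?_⟩⟩
    rw [addY, negAddY, H.2, sub_self, mul_zero, zero_add]

/-- Take `l = 2s + a₁` with `s` the tangent slope: the flex condition gives `l²`, and the formula
for `s` gives the product with `2y + a₁x + a₃`. -/
lemma exists_root_of_three_smul_eq_zero {W : WeierstrassCurve.Affine F} {x y : F}
    (h : W.Nonsingular x y) (h3 : 3 • Point.some x y h = 0) :
    ∃ l : F, l ^ 2 = 12 * x + W.b₂ ∧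
      l * (2 * y + W.a₁ * x + W.a₃) = 6 * x ^ 2 + W.b₂ * x + W.b₄ ∧
      l ^ 8 - 6 * W.c₄ * l ^ 4 - 8 * W.c₆ * l ^ 2 - 3 * W.c₄ ^ 2 = 0 := by
  obtain ⟨hy, hx⟩ := (three_smul_some_eq_zero_iff h).1 h3
  have heq := (W.equation_iff x y).1 h.1
  have hy' : 2 * y + W.a₁ * x + W.a₃ ≠ 0 := by
    intro h0
    apply hy
    rw [negY]
    linear_combination h0
  have hs : W.slope x x y y * (2 * y + W.a₁ * x + W.a₃) =
      3 * x ^ 2 + 2 * W.a₂ * x + W.a₄ - W.a₁ * y := by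
    rw [slope_of_Y_ne rfl hy, negY, show y - (-y - W.a₁ * x - W.a₃) =
      2 * y + W.a₁ * x + W.a₃ by ring, div_mul_cancel₀ _ hy']
  rw [addX] at hx
  generalize W.slope x x y y = s at hx hs
  have h2 : (2 * s + W.a₁) ^ 2 = 12 * x + W.b₂ := by
    simp only [b₂]
    linear_combination 4 * hx
  have h1 : (2 * s + W.a₁) * (2 * y + W.a₁ * x + W.a₃) = 6 * x ^ 2 + W.b₂ * x + W.b₄ := by
    simp only [b₂, b₄]
    linear_combination 2 * hs
  have he : (2 * y + W.a₁ * x + W.a₃) ^ 2 = 4 * x ^ 3 + W.b₂ * x ^ 2 + 2 * W.b₄ * x + W.b₆ := by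
    simp only [b₂, b₄, b₆]
    linear_combination 4 * heq
  refine ⟨2 * s + W.a₁, h2, h1, ?_⟩
  -- The two sides differ by four times the 3-division polynomial; substituting `l² = 12x + b₂` in γ
  -- gives 1728 times this difference.
  have hψ : (12 * x + W.b₂) * (4 * x ^ 3 + W.b₂ * x ^ 2 + 2 * W.b₄ * x + W.b₆) =
      (6 * x ^ 2 + W.b₂ * x + W.b₄) ^ 2 := by
    rw [← h2, ← he, ← h1]; ring
  rw [show (2 * s + W.a₁) ^ 8 = ((2 * s + W.a₁) ^ 2) ^ 4 by ring,
    show (2 * s + W.a₁) ^ 4 = ((2 * s + W.a₁) ^ 2) ^ 2 by ring, h2]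
  simp only [c₄, c₆]
  linear_combination 1728 * hψ

/-- The computation for torsion points runs backwards: cancelling `l²` gives the curve equation, and
then `l` is recognised as `2s + a₁`. -/
lemma three_smul_eq_zero_of_root [CharZero F] {W : WeierstrassCurve.Affine F} (hΔ : W.Δ ≠ 0) {x y l : F}
    (hl : l ≠ 0) (h2 : l ^ 2 = 12 * x + W.b₂)
    (h1 : l * (2 * y + W.a₁ * x + W.a₃) = 6 * x ^ 2 + W.b₂ * x + W.b₄)
    (h0 : l ^ 8 - 6 * W.c₄ * l ^ 4 - 8 * W.c₆ * l ^ 2 - 3 * W.c₄ ^ 2 = 0) :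
    2 * y + W.a₁ * x + W.a₃ ≠ 0 ∧
      ∃ h : W.Nonsingular x y, 3 • Point.some x y h = 0 := by
  have hψ : (12 * x + W.b₂) * (4 * x ^ 3 + W.b₂ * x ^ 2 + 2 * W.b₄ * x + W.b₆) =
      (6 * x ^ 2 + W.b₂ * x + W.b₄) ^ 2 := by
    rw [show l ^ 8 = (l ^ 2) ^ 4 by ring, show l ^ 4 = (l ^ 2) ^ 2 by ring, h2] at h0
    simp only [c₄, c₆] at h0
    linear_combination 1 / 1728 * h0
  have he : (2 * y + W.a₁ * x + W.a₃) ^ 2 = 4 * x ^ 3 + W.b₂ * x ^ 2 + 2 * W.b₄ * x + W.b₆ := by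
    apply mul_left_cancel₀ (pow_ne_zero 2 hl)
    rw [← mul_pow, h1, h2, hψ]
  have hns : W.Nonsingular x y := by
    rw [← equation_iff_nonsingular_of_Δ_ne_zero hΔ, equation_iff]
    simp only [b₂, b₄, b₆] at he
    linear_combination 1 / 4 * he
  -- Otherwise `h1` makes both partial derivatives vanish, contradicting nonsingularity.
  have hy' : 2 * y + W.a₁ * x + W.a₃ ≠ 0 := by
    intro hy
    rcases ((W.nonsingular_iff' x y).1 hns).2 with h | h
    · apply h
      rw [hy, mul_zero] at h1
      simp only [b₂, b₄] at h1
      linear_combination 1 / 2 * h1 + 1 / 2 * W.a₁ * hy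
    · exact h hy
  have hy : y ≠ W.negY x y := by
    intro h
    rw [negY] at h
    apply hy'
    linear_combination h
  refine ⟨hy', hns, (three_smul_some_eq_zero_iff hns).2 ⟨hy, ?_⟩⟩
  have hs : W.slope x x y y * (2 * y + W.a₁ * x + W.a₃) =
      3 * x ^ 2 + 2 * W.a₂ * x + W.a₄ - W.a₁ * y := by
    rw [slope_of_Y_ne rfl hy, negY, show y - (-y - W.a₁ * x - W.a₃) =
      2 * y + W.a₁ * x + W.a₃ by ring, div_mul_cancel₀ _ hy']
  have hls : 2 * W.slope x x y y + W.a₁ = l := by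
    apply mul_right_cancel₀ hy'
    rw [h1]
    simp only [b₂, b₄]
    linear_combination 2 * hs
  rw [← hls] at h2
  simp only [b₂] at h2
  rw [addX]
  linear_combination 1 / 4 * h2

end WeierstrassCurve.Affine

/-! ### The 3-torsion field as the splitting field of γ -/

section

variable {K : Type*} [Field K] (E : WeierstrassCurve K)

lemma gammaPoly_natDegree : (gammaPoly E).natDegree = 8 := by
  unfold gammaPoly; compute_degree!

lemma gammaPoly_monic : (gammaPoly E).Monic := by
  unfold gammaPoly; monicity!

lemma aeval_gammaPoly {A : Type*} [Field A] [Algebra K A] (l : A) :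
    aeval l (gammaPoly E) = l ^ 8 - 6 * algebraMap K A E.c₄ * l ^ 4
      - 8 * algebraMap K A E.c₆ * l ^ 2 - 3 * algebraMap K A E.c₄ ^ 2 := by
  simp [gammaPoly, map_ofNat (algebraMap K A)]

variable {E}

lemma c₄_ne_zero_of_irreducible_gammaPoly (hγ : Irreducible (gammaPoly E)) : E.c₄ ≠ 0 := by
  intro h0
  have hr : (gammaPoly E).IsRoot 0 := by simp [gammaPoly, h0]
  have := degree_eq_one_of_irreducible_of_root hγ hr
  rw [degree_eq_natDegree hγ.ne_zero, gammaPoly_natDegree] at this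
  norm_num at this

variable [CharZero K]

lemma root_ne_zero (hγ : Irreducible (gammaPoly E)) {A : Type*} [Field A] [Algebra K A] {l : A}
    (hl : aeval l (gammaPoly E) = 0) : l ≠ 0 := by
  rintro rfl
  have : CharZero A := charZero_of_injective_algebraMap (algebraMap K A).injective
  rw [aeval_gammaPoly] at hl
  simp [c₄_ne_zero_of_irreducible_gammaPoly hγ] at hl

variable [E.IsElliptic]

-- A root `l` and its point `(x, y)` determine each other rationally, because neither `l` nor `2y +
-- a₁x + a₃` vanishes.
open scoped Classical in
theorem torsionField_three_eq_adjoin_rootSet (hγ : Irreducible (gammaPoly E)) :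
    torsionField E 3 =
      IntermediateField.adjoin K ((gammaPoly E).rootSet (AlgebraicClosure K)) := by
  have : CharZero (AlgebraicClosure K) :=
    charZero_of_injective_algebraMap (algebraMap K _).injective
  set W := E.baseChange (AlgebraicClosure K) with hW
  have hΔ : W.toAffine.Δ ≠ 0 := by
    have : W.Δ = algebraMap K _ E.Δ := E.map_Δ _
    rw [WeierstrassCurve.toAffine, this]
    simpa using E.isUnit_Δ.ne_zero
  have ha1 : W.a₁ = algebraMap K _ E.a₁ := rfl
  have ha3 : W.a₃ = algebraMap K _ E.a₃ := rfl
  have hb2 : W.b₂ = algebraMap K _ E.b₂ := E.map_b₂ _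
  have hb4 : W.b₄ = algebraMap K _ E.b₄ := E.map_b₄ _
  have hc4 : W.c₄ = algebraMap K _ E.c₄ := E.map_c₄ _
  have hc6 : W.c₆ = algebraMap K _ E.c₆ := E.map_c₆ _
  have hroot (l : AlgebraicClosure K) : aeval l (gammaPoly E) = 0 ↔
      l ^ 8 - 6 * W.c₄ * l ^ 4 - 8 * W.c₆ * l ^ 2 - 3 * W.c₄ ^ 2 = 0 := by
    rw [aeval_gammaPoly, hc4, hc6]
  apply le_antisymm
  · rw [torsionField, IntermediateField.adjoin_le_iff]
    rintro t ⟨x, y, h, h3, ht⟩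
    obtain ⟨l, h2, h1, h0⟩ :=
      WeierstrassCurve.Affine.exists_root_of_three_smul_eq_zero h (by convert h3)
    have hl : aeval l (gammaPoly E) = 0 := (hroot l).2 h0
    set M := IntermediateField.adjoin K ((gammaPoly E).rootSet (AlgebraicClosure K))
    have hlM : l ∈ M := IntermediateField.subset_adjoin _ _
      (mem_rootSet.2 ⟨hγ.ne_zero, hl⟩)
    have hx : x = (l ^ 2 - W.b₂) / 12 := by
      change l ^ 2 = 12 * x + W.b₂ at h2
      rw [h2, add_sub_cancel_right, mul_div_cancel_left₀ _ (by norm_num)]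
    have hxM : x ∈ M := by
      rw [hx, hb2]
      exact M.div_mem (M.sub_mem (pow_mem hlM 2) (M.algebraMap_mem _)) (ofNat_mem M 12)
    have hy : y = ((6 * x ^ 2 + W.b₂ * x + W.b₄) / l - W.a₁ * x - W.a₃) / 2 := by
      have := root_ne_zero hγ hl
      change l * (2 * y + W.a₁ * x + W.a₃) = 6 * x ^ 2 + W.b₂ * x + W.b₄ at h1
      rw [← h1]
      field_simp
      ring
    have hyM : y ∈ M := by
      rw [hy, hb2, hb4, ha1, ha3]
      have := M.algebraMap_mem
      refine M.div_mem (M.sub_mem (M.sub_mem (M.div_mem (M.add_mem (M.add_mem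
        (M.mul_mem (ofNat_mem M 6) (pow_mem hxM 2)) (M.mul_mem (this _) hxM)) (this _)) hlM)
        (M.mul_mem (this _) hxM)) (this _)) (ofNat_mem M 2)
    rcases ht with rfl | rfl
    · exact hxM
    · exact hyM
  · rw [IntermediateField.adjoin_le_iff]
    intro l hl
    have hl : aeval l (gammaPoly E) = 0 := (mem_rootSet.1 hl).2
    have hl0 := root_ne_zero hγ hl
    set x := (l ^ 2 - W.b₂) / 12 with hx
    set y := ((6 * x ^ 2 + W.b₂ * x + W.b₄) / l - W.a₁ * x - W.a₃) / 2 with hy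
    have h1 : l * (2 * y + W.a₁ * x + W.a₃) = 6 * x ^ 2 + W.b₂ * x + W.b₄ := by
      rw [hy]; field_simp; ring
    obtain ⟨hη, h, h3⟩ := WeierstrassCurve.Affine.three_smul_eq_zero_of_root hΔ hl0
      (x := x) (y := y) (by rw [hx]; simp only [WeierstrassCurve.toAffine]; ring) h1
      ((hroot l).1 hl)
    have hlM : l = (6 * x ^ 2 + W.b₂ * x + W.b₄) / (2 * y + W.a₁ * x + W.a₃) := by
      rw [← h1]; exact (mul_div_cancel_right₀ _ hη).symm
    have hxM : x ∈ torsionField E 3 :=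
      IntermediateField.subset_adjoin _ _ ⟨x, y, h, by convert h3, Or.inl rfl⟩
    have hyM : y ∈ torsionField E 3 :=
      IntermediateField.subset_adjoin _ _ ⟨x, y, h, by convert h3, Or.inr rfl⟩
    generalize torsionField E 3 = M at hxM hyM ⊢
    rw [SetLike.mem_coe, hlM, hb2, hb4, ha1, ha3]
    have := M.algebraMap_mem
    exact M.div_mem (M.add_mem (M.add_mem
        (M.mul_mem (ofNat_mem M 6) (pow_mem hxM 2)) (M.mul_mem (this _) hxM)) (this _))
        (M.add_mem (M.add_mem (M.mul_mem (ofNat_mem M 2) hyM) (M.mul_mem (this _) hxM)) (this _))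

end

/-! ### Ferrari's formulas and the action on the radicals -/

/-- `a`, `b`, `c` are square roots of `c₄ - δ`, `c₄ - ω δ`, `c₄ - ω² δ` with product `c₆`. They give
the roots of `u ^ 4 - 6 c₄ u ^ 2 - 8 c₆ u - 3 c₄ ^ 2` by Ferrari's formulas. -/
structure IsFerrariRadicals {Ω : Type*} [Field Ω] (c₄ c₆ δ ω a b c : Ω) : Prop where
  omega : ω ^ 2 + ω + 1 = 0
  sq_a : a ^ 2 = c₄ - δ
  sq_b : b ^ 2 = c₄ - ω * δ
  sq_c : c ^ 2 = c₄ - ω ^ 2 * δ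
  mul_abc : a * b * c = c₆

namespace IsFerrariRadicals

variable {Ω : Type*} [Field Ω] {c₄ c₆ δ ω a b c : Ω}

/-- This change of signs reduces an automorphism with `b ↦ -c`, `c ↦ -b` to one that swaps `b` and
`c`. -/
lemma swap (h : IsFerrariRadicals c₄ c₆ δ ω a b c) :
    IsFerrariRadicals c₄ c₆ δ ω (-a) b (-c) :=
  ⟨h.omega, by rw [neg_sq, h.sq_a], h.sq_b, by rw [neg_sq, h.sq_c], by rw [← h.mul_abc]; ring⟩

/-- The coefficients of the quartic in `l²` depend only on `a² + b² + c² = 3c₄`, `a²b² + b²c² + c²a²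
= 3c₄²` and `abc = c₆`. -/
lemma eq_prod (h : IsFerrariRadicals c₄ c₆ δ ω a b c) (l : Ω) :
    l ^ 8 - 6 * c₄ * l ^ 4 - 8 * c₆ * l ^ 2 - 3 * c₄ ^ 2 =
      (l ^ 2 - (a + b + c)) * (l ^ 2 - (a - b - c)) * (l ^ 2 - (-a + b - c)) *
        (l ^ 2 - (-a - b + c)) := by
  have h1 : a ^ 2 + b ^ 2 + c ^ 2 = 3 * c₄ := by
    rw [h.sq_a, h.sq_b, h.sq_c]; linear_combination -δ * h.omega
  have h2 : a ^ 2 * b ^ 2 + b ^ 2 * c ^ 2 + c ^ 2 * a ^ 2 = 3 * c₄ ^ 2 := by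
    rw [h.sq_a, h.sq_b, h.sq_c]
    linear_combination (-2 * δ * c₄ + δ ^ 2 * ω) * h.omega
  have h3 := h.mul_abc
  linear_combination (2 * l ^ 4 - (a ^ 2 + b ^ 2 + c ^ 2 + 3 * c₄)) * h1 + 8 * l ^ 2 * h3 + 4 * h2

lemma root_iff (h : IsFerrariRadicals c₄ c₆ δ ω a b c) (l : Ω) :
    l ^ 8 - 6 * c₄ * l ^ 4 - 8 * c₆ * l ^ 2 - 3 * c₄ ^ 2 = 0 ↔
      l ^ 2 = a + b + c ∨ l ^ 2 = a - b - c ∨ l ^ 2 = -a + b - c ∨ l ^ 2 = -a - b + c := by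
  rw [h.eq_prod]
  simp only [mul_eq_zero, sub_eq_zero, or_assoc]

/-- Both sides equal `-c₄ - 2δ - 2bc`. So the product of two roots of γ with these squares lies in
the field of the radicals; the next two lemmas treat the other pairs. -/
lemma mul_ab (h : IsFerrariRadicals c₄ c₆ δ ω a b c) :
    (a + b + c) * (a - b - c) = (ω ^ 2 * c - ω * b) ^ 2 := by
  linear_combination h.sq_a - (1 + ω ^ 2) * h.sq_b - (1 + ω ^ 4) * h.sq_c +
    (2 * b * c * (ω - 1) - c₄ * (ω ^ 2 - ω + 1) + δ * (ω ^ 4 - ω ^ 3 + 2 * ω - 1)) * h.omega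

lemma mul_ac (h : IsFerrariRadicals c₄ c₆ δ ω a b c) :
    (a + b + c) * (-a + b - c) = (ω ^ 2 * a - ω * c) ^ 2 := by
  linear_combination h.sq_b - (1 + ω ^ 4) * h.sq_a - (1 + ω ^ 2) * h.sq_c +
    (2 * a * c * (ω - 1) - c₄ * (ω ^ 2 - ω + 1) + δ * (2 * ω ^ 2 - 2 * ω + 1)) * h.omega

lemma mul_ad (h : IsFerrariRadicals c₄ c₆ δ ω a b c) :
    (a + b + c) * (-a - b + c) = (ω * a - ω ^ 2 * b) ^ 2 := by
  linear_combination h.sq_c - (1 + ω ^ 2) * h.sq_a - (1 + ω ^ 4) * h.sq_b +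
    (2 * a * b * (ω - 1) - c₄ * (ω ^ 2 - ω + 1) + δ * (ω ^ 3 - ω ^ 2 + 1)) * h.omega

/-- An endomorphism that swaps `ω` with `ω²` and `b` with `c` is a reflection: it fixes a root. -/
lemma exists_fixed_root [IsAlgClosed Ω] [CharZero Ω] (h : IsFerrariRadicals c₄ c₆ δ ω a b c)
    {σ : Ω →+* Ω} (hω : σ ω = ω ^ 2) (ha : σ a = a) (hb : σ b = c) (hc : σ c = b) :
    ∃ l, l ^ 8 - 6 * c₄ * l ^ 4 - 8 * c₆ * l ^ 2 - 3 * c₄ ^ 2 = 0 ∧ σ l = l := by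
  obtain ⟨l, hl⟩ := IsAlgClosed.exists_pow_nat_eq (a + b + c) two_pos
  obtain ⟨m, hm⟩ := IsAlgClosed.exists_pow_nat_eq (a - b - c) two_pos
  have hl' := (h.root_iff l).2 (Or.inl hl)
  have hm' := (h.root_iff m).2 (Or.inr (Or.inl hm))
  have hω4 : (ω ^ 2) ^ 2 = ω := by linear_combination (ω ^ 2 - ω) * h.omega
  have hσl : σ l = l ∨ σ l = -l := by
    rw [← sq_eq_sq_iff_eq_or_eq_neg, ← map_pow, hl, map_add, map_add, ha, hb, hc]; ring
  have hσm : σ m = m ∨ σ m = -m := by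
    rw [← sq_eq_sq_iff_eq_or_eq_neg, ← map_pow, hm, map_sub, map_sub, ha, hb, hc]; ring
  have hlm : l * m = ω ^ 2 * c - ω * b ∨ l * m = -(ω ^ 2 * c - ω * b) := by
    rw [← sq_eq_sq_iff_eq_or_eq_neg, mul_pow, hl, hm, h.mul_ab]
  -- Since `σ` interchanges `ω²c` and `ωb`, it cannot negate both `l` and `m`.
  have hσlm : σ (l * m) = -(l * m) := by
    rcases hlm with hlm | hlm <;> rw [hlm] <;>
      simp only [map_neg, map_sub, map_mul, map_pow, hω, hb, hc, hω4] <;> ring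
  rcases hσl with hσl | hσl
  · exact ⟨l, hl', hσl⟩
  rcases hσm with hσm | hσm
  · exact ⟨m, hm', hσm⟩
  rw [map_mul, hσl, hσm, neg_mul_neg, self_eq_neg, mul_eq_zero] at hσlm
  rcases hσlm with rfl | rfl
  · exact ⟨0, hl', map_zero σ⟩
  · exact ⟨0, hm', map_zero σ⟩

/-- An endomorphism that swaps `ω` with `ω²` and changes the sign of `a` has order eight. -/
lemma iterate_four (h : IsFerrariRadicals c₄ c₆ δ ω a b c) {σ : Ω →+* Ω} (hω : σ ω = ω ^ 2)
    (hδ : σ δ = δ) (hc₄ : σ c₄ = c₄) (ha : σ a = -a) (hbc : σ (b * c) = -(b * c))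
    (hc0 : c ≠ 0) {l : Ω} (hl : l ^ 2 = a + b + c) :
    σ (σ (σ (σ l))) = -l := by
  have hω4 : (ω ^ 2) ^ 2 = ω := by linear_combination (ω ^ 2 - ω) * h.omega
  have hσb : σ b = c ∨ σ b = -c := by
    rw [← sq_eq_sq_iff_eq_or_eq_neg, ← map_pow, h.sq_b, h.sq_c, map_sub, map_mul, hω, hδ, hc₄]
  -- Negating `bc` forces exactly one sign in the swap of `b` and `c`, so the square of `σ` negates
  -- both.
  have hσσ : σ (σ b) = -b ∧ σ (σ c) = -c := by
    rw [map_mul] at hbc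
    rcases hσb with hb | hb
    · have hc : σ c = -b := by
        rw [hb] at hbc
        exact mul_left_cancel₀ hc0 (by linear_combination hbc)
      rw [hb, hc, map_neg, hb]; exact ⟨rfl, rfl⟩
    · have hc : σ c = b := by
        rw [hb] at hbc
        exact mul_left_cancel₀ hc0 (by linear_combination -hbc)
      rw [hb, hc, map_neg, hc, hb]; exact ⟨rfl, rfl⟩
  obtain ⟨hσσb, hσσc⟩ := hσσ
  have hσσa : σ (σ a) = a := by rw [ha, map_neg, ha, neg_neg]
  have hσσω : σ (σ ω) = ω := by rw [hω, map_pow, hω, hω4]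
  rcases eq_or_ne l 0 with rfl | hl0
  · simp
  -- As `σ²` negates `lm`, we get `m · σ²m = -lm`, and cancelling `m` gives `σ⁴l = -l`.
  set m := σ (σ l) with hm
  have hm2 : m ^ 2 = a - b - c := by
    rw [hm, ← map_pow, ← map_pow, hl]
    simp only [map_add, hσσa, hσσb, hσσc]; ring
  have hm0 : m ≠ 0 := by simpa [hm] using hl0
  have hlm : l * m = ω ^ 2 * c - ω * b ∨ l * m = -(ω ^ 2 * c - ω * b) := by
    rw [← sq_eq_sq_iff_eq_or_eq_neg, mul_pow, hl, hm2, h.mul_ab]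
  have hσlm : σ (σ (l * m)) = -(l * m) := by
    rcases hlm with hlm | hlm <;> rw [hlm] <;>
      simp only [map_neg, map_sub, map_mul, map_pow, hσσω, hσσb, hσσc] <;> ring
  rw [map_mul, map_mul, ← hm] at hσlm
  exact mul_left_cancel₀ hm0 (by linear_combination hσlm)

/-- The radicals and one nonzero root generate all the roots. -/
lemma fixes_roots (h : IsFerrariRadicals c₄ c₆ δ ω a b c) {σ : Ω →+* Ω} (hω : σ ω = ω)
    (ha : σ a = a) (hb : σ b = b) (hc : σ c = c) {l : Ω} (hl0 : l ≠ 0) (hl : l ^ 2 = a + b + c)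
    (hσl : σ l = l) {m : Ω}
    (hm : m ^ 8 - 6 * c₄ * m ^ 4 - 8 * c₆ * m ^ 2 - 3 * c₄ ^ 2 = 0) : σ m = m := by
  have key {t : Ω} (ht : σ t = t) (hlm : (l * m) ^ 2 = t ^ 2) : σ m = m := by
    have : σ (l * m) = l * m := by
      rcases sq_eq_sq_iff_eq_or_eq_neg.1 hlm with h | h <;> simp only [h, map_neg, ht]
    rw [map_mul, hσl] at this
    exact mul_left_cancel₀ hl0 this
  rcases (h.root_iff m).1 hm with hm | hm | hm | hm
  · exact key (t := a + b + c) (by simp only [map_add, ha, hb, hc])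
      (by rw [mul_pow, hl, hm]; ring)
  · exact key (t := ω ^ 2 * c - ω * b) (by simp only [map_sub, map_mul, map_pow, hω, hb, hc])
      (by rw [mul_pow, hl, hm, h.mul_ab])
  · exact key (t := ω ^ 2 * a - ω * c) (by simp only [map_sub, map_mul, map_pow, hω, ha, hc])
      (by rw [mul_pow, hl, hm, h.mul_ac])
  · exact key (t := ω * a - ω ^ 2 * b) (by simp only [map_sub, map_mul, map_pow, hω, ha, hb])
      (by rw [mul_pow, hl, hm, h.mul_ad])

/-- `b` and `c` are rational functions of `ω`, `δ`, `b + c`. -/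
lemma fixes_b_c [CharZero Ω] (h : IsFerrariRadicals c₄ c₆ δ ω a b c) {σ : Ω →+* Ω} (hω : σ ω = ω)
    (hδ : σ δ = δ) (hδ0 : (ω ^ 2 - ω) * δ ≠ 0) (hbc : σ (b + c) = b + c) : σ b = b ∧ σ c = c := by
  have hprod : (b + c) * (b - c) = (ω ^ 2 - ω) * δ := by
    linear_combination h.sq_b - h.sq_c
  have hne : b + c ≠ 0 := by
    intro h0
    rw [← hprod, h0, zero_mul] at hδ0
    exact hδ0 rfl
  have hsub : σ (b - c) = b - c := by
    apply mul_left_cancel₀ hne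
    nth_rewrite 1 [← hbc]
    rw [← map_mul, hprod]
    simp only [map_mul, map_sub, map_pow, hω, hδ]
  rw [map_add] at hbc
  rw [map_sub] at hsub
  constructor
  · linear_combination (1 / 2 : Ω) * hbc + (1 / 2 : Ω) * hsub
  · linear_combination (1 / 2 : Ω) * hbc - (1 / 2 : Ω) * hsub

/-- The product of four roots with different squares is `±√-3 c₄`. -/
lemma omega_eq (h : IsFerrariRadicals c₄ c₆ δ ω a b c) {l m n k : Ω} (hl : l ^ 2 = a + b + c)
    (hm : m ^ 2 = a - b - c) (hn : n ^ 2 = -a + b - c) (hk : k ^ 2 = -a - b + c) :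
    l * m * n * k = (2 * ω + 1) * c₄ ∨ l * m * n * k = -((2 * ω + 1) * c₄) := by
  -- The constant term gives the product of the four squares as `-3c₄²`, and `-3 = (2ω + 1)²`.
  have h0 := h.eq_prod 0
  rw [← sq_eq_sq_iff_eq_or_eq_neg]
  simp only [mul_pow, hl, hm, hn, hk]
  linear_combination -h0 - 4 * c₄ ^ 2 * h.omega

end IsFerrariRadicals

/-! ### Cube roots of unity and reducibility over `K(μ₃)` -/

section

lemma apply_omega_eq_sq {Ω : Type*} [Field Ω] {ω : Ω} (hω : ω ^ 2 + ω + 1 = 0) {σ : Ω →+* Ω}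
    (hσ : σ ω ≠ ω) : σ ω = ω ^ 2 := by
  have h := congrArg σ hω
  simp only [map_add, map_pow, map_one, map_zero] at h
  have : (σ ω - ω) * (σ ω - ω ^ 2) = 0 := by
    linear_combination h + (ω - 1 - σ ω) * hω
  exact sub_eq_zero.1 ((mul_eq_zero.1 this).resolve_left (sub_ne_zero.2 hσ))

lemma omega_sq_ne {Ω : Type*} [Field Ω] [CharZero Ω] {ω : Ω} (hω : ω ^ 2 + ω + 1 = 0) :
    ω ^ 2 ≠ ω := by
  intro h
  have : (3 : Ω) = 0 := by linear_combination 4 * hω - (2 * ω + 1) * (hω - h)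
  norm_num at this

lemma exists_omega (F : Type*) [Field F] [IsAlgClosed F] [CharZero F] :
    ∃ ω : F, ω ^ 2 + ω + 1 = 0 := by
  obtain ⟨t, ht⟩ := IsAlgClosed.exists_pow_nat_eq (-3 : F) two_pos
  exact ⟨(t - 1) / 2, by linear_combination (1 / 4 : F) * ht⟩

variable {K : Type*} [Field K]

lemma omega_mem_rootsOfUnityField_three {ω : AlgebraicClosure K} (hω : ω ^ 2 + ω + 1 = 0) :
    ω ∈ rootsOfUnityField K 3 :=
  IntermediateField.subset_adjoin _ _ (by
    rw [Set.mem_ofPred_eq]; linear_combination (ω - 1) * hω)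

lemma aeval_gammaPoly_apply {E : WeierstrassCurve K} (σ : Gal(AlgebraicClosure K/K)) {l : AlgebraicClosure K}
    (hl : aeval l (gammaPoly E) = 0) : aeval (σ l) (gammaPoly E) = 0 := by
  rw [aeval_algHom_apply σ, hl, map_zero]

variable [CharZero K]

lemma exists_apply_omega_eq_sq (hK : ∀ z : K, z ^ 2 + z + 1 ≠ 0) {ω : AlgebraicClosure K}
    (hω : ω ^ 2 + ω + 1 = 0) : ∃ σ : Gal(AlgebraicClosure K/K), σ ω = ω ^ 2 := by
  by_contra! hσ
  obtain ⟨z, hz⟩ := (InfiniteGalois.mem_range_algebraMap_iff_fixed ω).2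
    (fun σ : Gal(AlgebraicClosure K/K) => by
      by_contra h
      exact hσ σ (apply_omega_eq_sq hω (σ := (σ : AlgebraicClosure K →+* AlgebraicClosure K)) h))
  apply hK z
  apply (algebraMap K (AlgebraicClosure K)).injective
  simp [hz, hω]

lemma fixes_rootsOfUnityField_three {ω : AlgebraicClosure K} (hω : ω ^ 2 + ω + 1 = 0)
    {σ : Gal(AlgebraicClosure K/K)} (hσ : σ ω = ω) {x : AlgebraicClosure K}
    (hx : x ∈ rootsOfUnityField K 3) : σ x = x := by
  refine IntermediateField.adjoin_induction K (p := fun x _ => σ x = x) ?_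
    (fun x => σ.commutes x) (fun x y _ _ h₁ h₂ => by rw [map_add, h₁, h₂])
    (fun x _ h => by rw [map_inv₀, h]) (fun x y _ _ h₁ h₂ => by rw [map_mul, h₁, h₂]) hx
  intro z hz
  have hz' : (z - 1) * ((z - ω) * (z - ω ^ 2)) = 0 := by
    rw [Set.mem_ofPred_eq] at hz
    linear_combination hz + (-z ^ 2 + z * ω - ω + 1) * hω
  rcases mul_eq_zero.1 hz' with h | h
  · rw [sub_eq_zero.1 h, map_one]
  rcases mul_eq_zero.1 h with h | h
  · rw [sub_eq_zero.1 h, hσ]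
  · rw [sub_eq_zero.1 h, map_pow, hσ]

variable {E : WeierstrassCurve K}

lemma exists_apply_eq_of_roots (hγ : Irreducible (gammaPoly E)) {l m : AlgebraicClosure K}
    (hl : aeval l (gammaPoly E) = 0) (hm : aeval m (gammaPoly E) = 0) :
    ∃ σ : Gal(AlgebraicClosure K/K), σ l = m := by
  apply minpoly.exists_algEquiv_of_root' (Algebra.IsAlgebraic.isAlgebraic l)
  rwa [← minpoly.eq_of_irreducible_of_monic hγ hl (gammaPoly_monic E)]

lemma card_rootSet_gammaPoly (hγ : Irreducible (gammaPoly E)) :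
    Nat.card ((gammaPoly E).rootSet (AlgebraicClosure K)) = 8 := by
  rw [Nat.card_eq_fintype_card, card_rootSet_eq_natDegree hγ.separable
    (IsAlgClosed.splits _), gammaPoly_natDegree]

/-- The automorphisms fixing `ω` have index two. They remain transitive on the roots exactly when
the stabilizer of a root contains an element moving `ω`. -/
lemma irreducible_map_iff (hγ : Irreducible (gammaPoly E))
    (hK : ∀ z : K, z ^ 2 + z + 1 ≠ 0) {ω : AlgebraicClosure K}
    (hω : ω ^ 2 + ω + 1 = 0) :
    ¬ Irreducible ((gammaPoly E).map (algebraMap K (rootsOfUnityField K 3))) ↔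
      ∀ l, aeval l (gammaPoly E) = 0 → ∀ σ : Gal(AlgebraicClosure K/K), σ l = l → σ ω = ω := by
  set F := rootsOfUnityField K 3
  have hmonic : ((gammaPoly E).map (algebraMap K F)).Monic := (gammaPoly_monic E).map _
  constructor
  · intro hred l hl σ₀ hσ₀ 
    by_contra hσω
    apply hred
    have hroot : aeval l ((gammaPoly E).map (algebraMap K F)) = 0 := by
      rwa [aeval_map_algebraMap]
    have hint : IsIntegral F l := Algebra.IsIntegral.isIntegral l
    have hdvd := minpoly.dvd F l hroot
    suffices h : 8 ≤ (minpoly F l).natDegree by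
      rw [eq_of_monic_of_dvd_of_natDegree_le (minpoly.monic hint) hmonic hdvd
        (by rwa [(gammaPoly_monic E).natDegree_map, gammaPoly_natDegree])]
      exact minpoly.irreducible hint
    rw [← card_rootSet_gammaPoly hγ, Nat.card_coe_set_eq]
    refine le_trans (Set.ncard_le_ncard ?_ (rootSet_finite _ _))
      (ncard_rootSet_le (minpoly F l) (AlgebraicClosure K))
    intro m hm
    obtain ⟨σ, hσ, hσω'⟩ : ∃ σ : Gal(AlgebraicClosure K/K), σ l = m ∧ σ ω = ω := by
      obtain ⟨σ, hσ⟩ := exists_apply_eq_of_roots hγ hl (mem_rootSet.1 hm).2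
      by_cases h : σ ω = ω
      · exact ⟨σ, hσ, h⟩
      -- Composing with `σ₀`, which fixes `l` and moves `ω`, repairs the action on `ω` without
      -- changing the image of `l`.
      refine ⟨σ * σ₀, by rw [AlgEquiv.mul_apply, hσ₀, hσ], ?_⟩
      have h1 : σ ω = ω ^ 2 := apply_omega_eq_sq hω (σ := (σ : _ →+* AlgebraicClosure K)) h
      have h2 : σ₀ ω = ω ^ 2 := apply_omega_eq_sq hω (σ := (σ₀ : _ →+* AlgebraicClosure K)) hσω
      rw [AlgEquiv.mul_apply, h2, map_pow, h1]
      linear_combination (ω ^ 2 - ω) * hω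
    let τ : AlgebraicClosure K →ₐ[F] AlgebraicClosure K :=
      { (σ : AlgebraicClosure K →+* AlgebraicClosure K) with
        commutes' := fun x => fixes_rootsOfUnityField_three hω hσω' x.2 }
    rw [mem_rootSet, ← hσ]
    refine ⟨minpoly.ne_zero hint, ?_⟩
    change aeval (τ l) _ = 0
    rw [aeval_algHom_apply, minpoly.aeval, map_zero]
  · intro h hirr
    obtain ⟨l, hl⟩ := IsAlgClosed.exists_aeval_eq_zero (AlgebraicClosure K) (gammaPoly E)
      (by rw [degree_eq_natDegree hγ.ne_zero, gammaPoly_natDegree]; norm_num)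
    obtain ⟨σ, hσ⟩ := exists_apply_omega_eq_sq hK hω
    have hev : aeval (σ l) (minpoly F l) = 0 := by
      rw [← minpoly.eq_of_irreducible_of_monic hirr (by rwa [aeval_map_algebraMap]) hmonic,
        aeval_map_algebraMap]
      exact aeval_gammaPoly_apply σ hl
    obtain ⟨τ, hτ⟩ := minpoly.exists_algEquiv_of_root' (Algebra.IsAlgebraic.isAlgebraic l) hev
    have hτω : τ ω = ω := τ.commutes ⟨ω, omega_mem_rootsOfUnityField_three hω⟩
    have h1 := h l hl ((τ.restrictScalars K)⁻¹ * σ) (by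
      rw [AlgEquiv.mul_apply, AlgEquiv.aut_inv, AlgEquiv.symm_apply_eq]
      exact hτ.symm)
    rw [AlgEquiv.mul_apply, AlgEquiv.aut_inv, AlgEquiv.symm_apply_eq] at h1
    have h2 : σ ω = ω := h1.trans hτω
    exact omega_sq_ne hω (hσ.symm.trans h2)

end

/-! ### Freeness, squares and the cyclic group -/

section

lemma omega_norm {Ω : Type*} [Field Ω] {ω : Ω} (hω : ω ^ 2 + ω + 1 = 0) (x y : Ω) :
    (x - ω * y) * (x - ω ^ 2 * y) = x ^ 2 + x * y + y ^ 2 := by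
  linear_combination (y ^ 2 * (ω - 1) - x * y) * hω

variable {K : Type*} [Field K] {E : WeierstrassCurve K}

variable (E) in
/-- The cube root `δ` of `12 ^ 3 Δ` and a choice of square roots in `AlgebraicClosure K`. -/
abbrev FerrariData (δ : K) (ω a b c : AlgebraicClosure K) : Prop :=
  IsFerrariRadicals (algebraMap K (AlgebraicClosure K) E.c₄) (algebraMap K _ E.c₆)
    (algebraMap K _ δ) ω a b c

variable {δ : K} {ω a b c : AlgebraicClosure K}

lemma FerrariData.aeval_eq_zero_iff (h : FerrariData E δ ω a b c) (l : AlgebraicClosure K) :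
    aeval l (gammaPoly E) = 0 ↔
      l ^ 2 = a + b + c ∨ l ^ 2 = a - b - c ∨ l ^ 2 = -a + b - c ∨ l ^ 2 = -a - b + c := by
  rw [aeval_gammaPoly, h.root_iff]

variable [CharZero K]

lemma normal_torsionField_three [E.IsElliptic] (hγ : Irreducible (gammaPoly E)) :
    Normal K (torsionField E 3) := by
  rw [torsionField_three_eq_adjoin_rootSet hγ]
  have := IntermediateField.adjoin_rootSet_isSplittingField (K := K)
    (IsAlgClosed.splits ((gammaPoly E).map (algebraMap K (AlgebraicClosure K))))
  exact Normal.of_isSplittingField (gammaPoly E)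

lemma fixes_torsionField_three [E.IsElliptic] (hγ : Irreducible (gammaPoly E))
    {σ : Gal(AlgebraicClosure K/K)} (hσ : ∀ l, aeval l (gammaPoly E) = 0 → σ l = l)
    {x : AlgebraicClosure K} (hx : x ∈ torsionField E 3) : σ x = x := by
  rw [torsionField_three_eq_adjoin_rootSet hγ] at hx
  exact IntermediateField.adjoin_induction K (p := fun x _ => σ x = x)
    (fun l hl => hσ l (mem_rootSet.1 hl).2)
    (fun x => σ.commutes x) (fun x y _ _ h₁ h₂ => by rw [map_add, h₁, h₂])
    (fun x _ h => by rw [map_inv₀, h]) (fun x y _ _ h₁ h₂ => by rw [map_mul, h₁, h₂]) hx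

lemma root_mem_torsionField_three [E.IsElliptic] (hγ : Irreducible (gammaPoly E))
    {l : AlgebraicClosure K} (hl : aeval l (gammaPoly E) = 0) : l ∈ torsionField E 3 := by
  rw [torsionField_three_eq_adjoin_rootSet hγ]
  exact IntermediateField.subset_adjoin _ _ (mem_rootSet.2 ⟨hγ.ne_zero, hl⟩)

/-- A product of four roots is `±√-3 c₄`, and `c₄ ≠ 0`. -/
lemma FerrariData.omega_mem_torsionField [E.IsElliptic] (hγ : Irreducible (gammaPoly E))
    (h : FerrariData E δ ω a b c) : ω ∈ torsionField E 3 := by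
  have hmem {l : AlgebraicClosure K} (hl : aeval l (gammaPoly E) = 0) :=
    root_mem_torsionField_three hγ hl
  obtain ⟨l, hl⟩ := IsAlgClosed.exists_pow_nat_eq (a + b + c) two_pos
  obtain ⟨m, hm⟩ := IsAlgClosed.exists_pow_nat_eq (a - b - c) two_pos
  obtain ⟨n, hn⟩ := IsAlgClosed.exists_pow_nat_eq (-a + b - c) two_pos
  obtain ⟨k, hk⟩ := IsAlgClosed.exists_pow_nat_eq (-a - b + c) two_pos
  have hl' := hmem ((h.aeval_eq_zero_iff l).2 (Or.inl hl))
  have hm' := hmem ((h.aeval_eq_zero_iff m).2 (Or.inr (Or.inl hm)))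
  have hn' := hmem ((h.aeval_eq_zero_iff n).2 (Or.inr (Or.inr (Or.inl hn))))
  have hk' := hmem ((h.aeval_eq_zero_iff k).2 (Or.inr (Or.inr (Or.inr hk))))
  have hc₄ : algebraMap K (AlgebraicClosure K) E.c₄ ≠ 0 := by
    simpa using c₄_ne_zero_of_irreducible_gammaPoly hγ
  have hlmnk := mul_mem (mul_mem (mul_mem hl' hm') hn') hk'
  have h3 : (2 * ω + 1) * algebraMap K (AlgebraicClosure K) E.c₄ ∈ torsionField E 3 := by
    rcases h.omega_eq hl hm hn hk with h | h
    · rwa [h] at hlmnk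
    · rwa [h, neg_mem_iff] at hlmnk
  have hω : ω = ((2 * ω + 1) * algebraMap K (AlgebraicClosure K) E.c₄ /
      algebraMap K (AlgebraicClosure K) E.c₄ - 1) / 2 := by
    rw [mul_div_cancel_right₀ _ hc₄]; ring
  rw [hω]
  exact div_mem (sub_mem (div_mem h3 ((torsionField E 3).algebraMap_mem _)) (one_mem _))
    (ofNat_mem _ 2)

/-- If the Galois group has only eight elements, it permutes the roots freely. -/
lemma apply_omega_of_card_eq_eight [E.IsElliptic] (hγ : Irreducible (gammaPoly E))
    (hω : ω ∈ torsionField E 3)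
    (hcard : Nat.card (torsionField E 3 ≃ₐ[K] torsionField E 3) = 8) {l : AlgebraicClosure K}
    (hl : aeval l (gammaPoly E) = 0) {σ : Gal(AlgebraicClosure K/K)} (hσ : σ l = l) :
    σ ω = ω := by
  have := normal_torsionField_three hγ
  have hres (τ : Gal(AlgebraicClosure K/K)) (x : torsionField E 3) :
      ((AlgEquiv.restrictNormalHom (torsionField E 3) τ x : torsionField E 3) :
        AlgebraicClosure K) = τ x := AlgEquiv.restrictNormal_commutes τ (torsionField E 3) x
  let x : torsionField E 3 := ⟨l, root_mem_torsionField_three hγ hl⟩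
  let f : (torsionField E 3 ≃ₐ[K] torsionField E 3) →
      (gammaPoly E).rootSet (AlgebraicClosure K) := fun g => ⟨g x, mem_rootSet.2 ⟨hγ.ne_zero, by
    rw [← IntermediateField.algebraMap_apply, aeval_algebraMap_apply, aeval_algHom_apply g]
    have hx : algebraMap (torsionField E 3) (AlgebraicClosure K) (aeval x (gammaPoly E)) = 0 := by
      rw [← aeval_algebraMap_apply]; exact hl
    rw [map_eq_zero] at hx
    rw [hx, map_zero, map_zero]⟩⟩
  have hsurj : Function.Surjective f := by
    rintro ⟨m, hm⟩
    obtain ⟨τ, hτ⟩ := exists_apply_eq_of_roots hγ hl (mem_rootSet.1 hm).2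
    exact ⟨AlgEquiv.restrictNormalHom _ τ, Subtype.ext ((hres τ x).trans hτ)⟩
  have : Finite (torsionField E 3 ≃ₐ[K] torsionField E 3) :=
    Nat.finite_of_card_ne_zero (by rw [hcard]; norm_num)
  -- A surjection between two sets of eight elements is injective, so stabilizers are trivial.
  have hinj : Function.Injective f := ((Nat.bijective_iff_surjective_and_card f).2
    ⟨hsurj, by rw [hcard, card_rootSet_gammaPoly hγ]⟩).1
  have h1 : AlgEquiv.restrictNormalHom (torsionField E 3) σ = 1 :=
    hinj (Subtype.ext ((hres σ x).trans hσ))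
  have := hres σ ⟨ω, hω⟩
  rw [h1] at this
  exact this.symm

/-- With no reflections fixing a root, every automorphism acts on `bc`, hence on `a`, by the same
sign as on `ω - ω² = ±√-3`. The products are then in `K`. -/
lemma FerrariData.isSquare_of_free (h : FerrariData E δ ω a b c)
    (hK : ∀ z : K, z ^ 2 + z + 1 ≠ 0) (hb0 : b ≠ 0) (hc0 : c ≠ 0)
    (hfree : ∀ l, aeval l (gammaPoly E) = 0 →
      ∀ σ : Gal(AlgebraicClosure K/K), σ l = l → σ ω = ω) :
    IsSquare (-3 * (E.c₄ - δ)) ∧ IsSquare (-3 * (E.c₄ ^ 2 + E.c₄ * δ + δ ^ 2)) := by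
  have hωK := omega_sq_ne h.omega
  have habc (σ : Gal(AlgebraicClosure K/K)) : σ a * σ (b * c) = a * (b * c) := by
    rw [← map_mul, ← mul_assoc, h.mul_abc]; exact σ.commutes _
  have hbc0 : b * c ≠ 0 := mul_ne_zero hb0 hc0
  have hneg (σ : Gal(AlgebraicClosure K/K)) (hσ : σ ω = ω ^ 2) : σ (b * c) = -(b * c) := by
    have hω4 : (ω ^ 2) ^ 2 = ω := by linear_combination (ω ^ 2 - ω) * h.omega
    have hsqb : (σ b) ^ 2 = c ^ 2 := by
      rw [← map_pow, h.sq_b, h.sq_c, map_sub, map_mul, hσ, σ.commutes, σ.commutes]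
    have hsqc : (σ c) ^ 2 = b ^ 2 := by
      rw [← map_pow, h.sq_b, h.sq_c, map_sub, map_mul, map_pow, hσ, hω4, σ.commutes, σ.commutes]
    have hσbc := habc σ
    have ne_of_fixed {l : AlgebraicClosure K} (hl : l ^ 8 - 6 * algebraMap K _ E.c₄ * l ^ 4
        - 8 * algebraMap K _ E.c₆ * l ^ 2 - 3 * algebraMap K _ E.c₄ ^ 2 = 0) (hσl : σ l = l) :
        False := by
      rw [← aeval_gammaPoly] at hl
      exact hωK (hσ.symm.trans (hfree l hl σ hσl))
    rw [map_mul] at hσbc ⊢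
    rcases sq_eq_sq_iff_eq_or_eq_neg.1 hsqb with hb | hb <;>
    rcases sq_eq_sq_iff_eq_or_eq_neg.1 hsqc with hc | hc
    · have ha : σ a = a := mul_right_cancel₀ hbc0 (by rw [← hσbc, hb, hc, mul_comm b])
      obtain ⟨l, hl, hσl⟩ := h.exists_fixed_root
        (σ := (σ : AlgebraicClosure K →+* AlgebraicClosure K)) hσ ha hb hc
      exact (ne_of_fixed hl hσl).elim
    · rw [hb, hc]; ring
    · rw [hb, hc]; ring
    · have ha : σ a = a := mul_right_cancel₀ hbc0 (by rw [← hσbc, hb, hc]; ring)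
      obtain ⟨l, hl, hσl⟩ := h.swap.exists_fixed_root
        (σ := (σ : AlgebraicClosure K →+* AlgebraicClosure K)) hσ
        (by rw [map_neg]; exact congrArg _ ha) hb (by
          rw [map_neg]; change -σ c = b; rw [hc, neg_neg])
      exact (ne_of_fixed hl hσl).elim
  obtain ⟨σ₀, hσ₀⟩ := exists_apply_omega_eq_sq hK h.omega
  have hcases (σ : Gal(AlgebraicClosure K/K)) :
      σ ω = ω ∧ σ (b * c) = b * c ∨ σ ω = ω ^ 2 ∧ σ (b * c) = -(b * c) := by
    by_cases hσ : σ ω = ω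
    · left
      refine ⟨hσ, ?_⟩
      -- Both `σ₀` and `σσ₀` move `ω` and so negate `bc`; hence `σ` fixes it.
      have h1 := hneg (σ * σ₀) (by rw [AlgEquiv.mul_apply, hσ₀, map_pow, hσ])
      rw [AlgEquiv.mul_apply, hneg σ₀ hσ₀, map_neg, neg_inj] at h1
      exact h1
    · right
      have h2 : σ ω = ω ^ 2 := apply_omega_eq_sq h.omega (σ := (σ : _ →+* AlgebraicClosure K)) hσ
      exact ⟨h2, hneg σ h2⟩
  have hθ : (ω - ω ^ 2) ^ 2 = -3 := by
    linear_combination (ω ^ 2 - 3 * ω + 3) * h.omega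
  have hω4 : (ω ^ 2) ^ 2 = ω := by linear_combination (ω ^ 2 - ω) * h.omega
  have hsquare {t : AlgebraicClosure K} {s : K} (ht : ∀ σ : Gal(AlgebraicClosure K/K), σ t = t)
      (hs : t ^ 2 = algebraMap K _ s) : IsSquare s := by
    obtain ⟨r, rfl⟩ := (InfiniteGalois.mem_range_algebraMap_iff_fixed t).2 ht
    refine ⟨r, (algebraMap K (AlgebraicClosure K)).injective ?_⟩
    rw [← hs, map_mul, sq]
  constructor
  · refine hsquare (t := (ω - ω ^ 2) * a) (fun σ => ?_) ?_
    · apply mul_right_cancel₀ hbc0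
      have := habc σ
      rcases hcases σ with ⟨h1, h2⟩ | ⟨h1, h2⟩
      · rw [h2] at this
        rw [map_mul, map_sub, map_pow, h1, mul_assoc, this, ← mul_assoc]
      · rw [h2] at this
        rw [map_mul, map_sub, map_pow, h1, hω4]
        linear_combination (ω - ω ^ 2) * this
    · rw [mul_pow, hθ, h.sq_a]; simp [map_ofNat (algebraMap K (AlgebraicClosure K))]
  · refine hsquare (t := (ω - ω ^ 2) * (b * c)) (fun σ => ?_) ?_
    · rcases hcases σ with ⟨h1, h2⟩ | ⟨h1, h2⟩
      · rw [map_mul, map_sub, map_pow, h1, h2]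
      · rw [map_mul, map_sub, map_pow, h1, h2, hω4]; ring
    · rw [mul_pow, hθ, mul_pow, h.sq_b, h.sq_c, omega_norm h.omega]
      simp only [map_mul, map_add, map_pow, map_neg, map_ofNat]

/-- If both elements are squares, the Galois group is generated by any element moving `ω`. -/
lemma FerrariData.nonempty_mulEquiv [E.IsElliptic] (hγ : Irreducible (gammaPoly E))
    (h : FerrariData E δ ω a b c) (hK : ∀ z : K, z ^ 2 + z + 1 ≠ 0) (hδ0 : δ ≠ 0)
    (hc0 : c ≠ 0)
    (hsa : IsSquare (-3 * (E.c₄ - δ)))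
    (hsbc : IsSquare (-3 * (E.c₄ ^ 2 + E.c₄ * δ + δ ^ 2))) :
    Nonempty ((torsionField E 3 ≃ₐ[K] torsionField E 3) ≃* Multiplicative (ZMod 8)) := by
  have hθ : (ω - ω ^ 2) ^ 2 = -3 := by
    linear_combination (ω ^ 2 - 3 * ω + 3) * h.omega
  have hω4 : (ω ^ 2) ^ 2 = ω := by linear_combination (ω ^ 2 - ω) * h.omega
  have hθ0 : ω - ω ^ 2 ≠ 0 := by
    intro h0
    rw [h0] at hθ
    norm_num at hθ
  have hrat {t : AlgebraicClosure K} {s : K} (hs : IsSquare s) (hst : t ^ 2 = algebraMap K _ s)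
      (σ : Gal(AlgebraicClosure K/K)) : σ t = t := by
    obtain ⟨r, rfl⟩ := hs
    rw [map_mul, ← sq] at hst
    rcases sq_eq_sq_iff_eq_or_eq_neg.1 hst with rfl | rfl
    · exact σ.commutes r
    · rw [map_neg, σ.commutes]
  have hfixa := hrat (t := (ω - ω ^ 2) * a) hsa (by rw [mul_pow, hθ, h.sq_a]; simp [map_ofNat (algebraMap K (AlgebraicClosure K))])
  have hfixbc := hrat (t := (ω - ω ^ 2) * (b * c)) hsbc (by
    rw [mul_pow, hθ, mul_pow, h.sq_b, h.sq_c, omega_norm h.omega]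
    simp only [map_mul, map_add, map_pow, map_neg, map_ofNat])
  obtain ⟨l, hl⟩ := IsAlgClosed.exists_pow_nat_eq (a + b + c) two_pos
  have hlγ := (h.aeval_eq_zero_iff l).2 (Or.inl hl)
  have hl0 := root_ne_zero hγ hlγ
  have hfour (σ : Gal(AlgebraicClosure K/K)) (hσ : σ ω = ω ^ 2) : σ (σ (σ (σ l))) = -l := by
    refine h.iterate_four (σ := (σ : AlgebraicClosure K →+* AlgebraicClosure K)) hσ
      (σ.commutes _) (σ.commutes _) ?_ ?_ hc0 hl
    · have := hfixa σ
      rw [map_mul, map_sub, map_pow, hσ, hω4] at this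
      exact mul_left_cancel₀ hθ0 (by change _ * σ a = _; linear_combination -this)
    · have := hfixbc σ
      rw [map_mul, map_sub, map_pow, hσ, hω4] at this
      exact mul_left_cancel₀ hθ0 (by change _ * σ (b * c) = _; linear_combination -this)
  -- Fixing `l` forces `ω` to be fixed, then `a`, then `b + c = l² - a`, hence all radicals and all
  -- roots.
  have hfree (σ : Gal(AlgebraicClosure K/K)) (hσl : σ l = l) {m : AlgebraicClosure K}
      (hm : aeval m (gammaPoly E) = 0) : σ m = m := by
    have hω : σ ω = ω := by
      by_contra hne
      have := hfour σ (apply_omega_eq_sq h.omega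
        (σ := (σ : AlgebraicClosure K →+* AlgebraicClosure K)) hne)
      simp only [hσl] at this
      exact hl0 (self_eq_neg.1 this)
    have ha : σ a = a := by
      have := hfixa σ
      rw [map_mul, map_sub, map_pow, hω] at this
      exact mul_left_cancel₀ hθ0 this
    have hbc : σ (b + c) = b + c := by
      have h1 : σ (l ^ 2) = l ^ 2 := by rw [map_pow, hσl]
      rw [hl, add_assoc, map_add, ha] at h1
      exact add_left_cancel h1
    obtain ⟨hb, hc⟩ := h.fixes_b_c (σ := (σ : AlgebraicClosure K →+* AlgebraicClosure K)) hω
      (σ.commutes δ) (mul_ne_zero (by rwa [← neg_sub, neg_ne_zero]) (by simpa using hδ0)) hbc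
    rw [aeval_gammaPoly] at hm
    exact h.fixes_roots (σ := (σ : AlgebraicClosure K →+* AlgebraicClosure K)) hω ha hb hc hl0 hl
      hσl hm
  have := normal_torsionField_three hγ
  have hres (τ : Gal(AlgebraicClosure K/K)) (x : torsionField E 3) :
      ((AlgEquiv.restrictNormalHom (torsionField E 3) τ x : torsionField E 3) :
        AlgebraicClosure K) = τ x := AlgEquiv.restrictNormal_commutes τ (torsionField E 3) x
  have hone (τ : Gal(AlgebraicClosure K/K)) (hτ : τ l = l) :
      AlgEquiv.restrictNormalHom (torsionField E 3) τ = 1 := by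
    ext x
    rw [hres]
    exact fixes_torsionField_three hγ (fun m hm => hfree τ hτ hm) x.2
  obtain ⟨σ, hσ⟩ := exists_apply_omega_eq_sq hK h.omega
  have hσ4 : (σ ^ 4) l = -l := hfour σ hσ
  have horder : orderOf (AlgEquiv.restrictNormalHom (torsionField E 3) σ) = 8 := by
    refine orderOf_eq_prime_pow (p := 2) (n := 2) ?_ ?_
    · intro h1
      rw [← map_pow] at h1
      have := hres (σ ^ 2 ^ 2) ⟨l, root_mem_torsionField_three hγ hlγ⟩
      rw [h1] at this
      exact hl0 (self_eq_neg.1 (this.trans hσ4))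
    · rw [← map_pow]
      apply hone
      rw [show 2 ^ (2 + 1) = 4 + 4 from rfl, pow_add, AlgEquiv.mul_apply, hσ4, map_neg, hσ4,
        neg_neg]
  let x : torsionField E 3 := ⟨l, root_mem_torsionField_three hγ hlγ⟩
  let f : (torsionField E 3 ≃ₐ[K] torsionField E 3) →
      (gammaPoly E).rootSet (AlgebraicClosure K) := fun g => ⟨g x, mem_rootSet.2 ⟨hγ.ne_zero, by
    obtain ⟨τ, rfl⟩ := AlgEquiv.restrictNormalHom_surjective (AlgebraicClosure K) g
    rw [hres]
    exact aeval_gammaPoly_apply τ hlγ⟩⟩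
  have hinj : Function.Injective f := by
    intro g₁ g₂ hg
    obtain ⟨τ₁, rfl⟩ := AlgEquiv.restrictNormalHom_surjective (AlgebraicClosure K) g₁
    obtain ⟨τ₂, rfl⟩ := AlgEquiv.restrictNormalHom_surjective (AlgebraicClosure K) g₂
    have hg' : τ₁ l = τ₂ l := by
      have := congrArg Subtype.val hg
      simpa only [f, hres] using this
    rw [← inv_mul_eq_one, ← map_inv, ← map_mul]
    apply hone
    rw [AlgEquiv.mul_apply, AlgEquiv.aut_inv, AlgEquiv.symm_apply_eq, hg']
  have : Finite (torsionField E 3 ≃ₐ[K] torsionField E 3) := Finite.of_injective f hinj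
  -- The eight roots bound the order above, and the element of order 8 bounds it below.
  have hcard : Nat.card (torsionField E 3 ≃ₐ[K] torsionField E 3) = 8 := by
    apply le_antisymm
    · rw [← card_rootSet_gammaPoly hγ]
      exact Nat.card_le_card_of_injective f hinj
    · rw [← horder]
      exact orderOf_le_card
  have hcyc := isCyclic_of_orderOf_eq_card _ (horder.trans hcard.symm)
  have e := zmodCyclicMulEquiv hcyc
  rw [hcard] at e
  exact ⟨e.symm⟩

end

/-! ### The main theorem -/

theorem lemma3p2 {K : Type*} [Field K] [Algebra ℚ_[2] K] [FiniteDimensional ℚ_[2] K]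
    (E : WeierstrassCurve K) [E.IsElliptic] (δ : K)
    (hδ : ∀ x : K, (X ^ 3 - C (12 ^ 3 * E.Δ) : K[X]).IsRoot x ↔ x = δ)
    (hγ : Irreducible (gammaPoly E)) :
    List.TFAE
      [ Nonempty ((torsionField E 3 ≃ₐ[K] torsionField E 3) ≃* Multiplicative (ZMod 8)),
        ¬ Irreducible ((gammaPoly E).map (algebraMap K (rootsOfUnityField K 3))),
        IsSquare (-3 * (E.c₄ - δ)) ∧ IsSquare (-3 * (E.c₄ ^ 2 + E.c₄ * δ + δ ^ 2)) ] ∧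
    (E.c₆ ≠ 0 →
      (IsSquare (-3 * (E.c₄ - δ)) ↔ IsSquare (-3 * (E.c₄ ^ 2 + E.c₄ * δ + δ ^ 2)))) := by
  have : CharZero K := charZero_of_injective_algebraMap (algebraMap ℚ_[2] K).injective
  have hcube : δ ^ 3 = 12 ^ 3 * E.Δ := by
    simpa [sub_eq_zero, map_ofNat] using (hδ δ).2 rfl
  have hrel : (E.c₄ - δ) * (E.c₄ ^ 2 + E.c₄ * δ + δ ^ 2) = E.c₆ ^ 2 := by
    linear_combination -hcube - E.c_relation
  have hδ0 : δ ≠ 0 := by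
    rintro rfl
    have : (12 : K) ^ 3 * E.Δ ≠ 0 := mul_ne_zero (by norm_num) E.isUnit_Δ.ne_zero
    exact this (by rw [← hcube]; ring)
  -- A primitive cube root of unity `z` in `K` would give the second root `zδ`.
  have hK (z : K) : z ^ 2 + z + 1 ≠ 0 := by
    intro hz
    have h1 : z * δ = δ := (hδ _).1 (by
      have : (z * δ) ^ 3 = 12 ^ 3 * E.Δ := by
        linear_combination hcube + δ ^ 3 * (z - 1) * hz
      simp [this, map_ofNat])
    have h2 : z = 1 := mul_right_cancel₀ hδ0 (by rw [h1, one_mul])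
    rw [h2] at hz
    norm_num at hz
  refine ⟨?_, fun hc₆ => ?_⟩
  · have : CharZero (AlgebraicClosure K) :=
      charZero_of_injective_algebraMap (algebraMap K _).injective
    obtain ⟨ω, hω⟩ := exists_omega (AlgebraicClosure K)
    obtain ⟨b, hb⟩ := IsAlgClosed.exists_pow_nat_eq
      (algebraMap K (AlgebraicClosure K) E.c₄ - ω * algebraMap K _ δ) two_pos
    obtain ⟨c, hc⟩ := IsAlgClosed.exists_pow_nat_eq
      (algebraMap K (AlgebraicClosure K) E.c₄ - ω ^ 2 * algebraMap K _ δ) two_pos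
    obtain ⟨σ, hσ⟩ := exists_apply_omega_eq_sq hK hω
    have hω4 : (ω ^ 2) ^ 2 = ω := by linear_combination (ω ^ 2 - ω) * hω
    have hδ0' : algebraMap K (AlgebraicClosure K) δ ≠ 0 := by simpa using hδ0
    have hωδ : (ω ^ 2 - ω) * algebraMap K (AlgebraicClosure K) δ ≠ 0 :=
      mul_ne_zero (sub_ne_zero.2 (omega_sq_ne hω)) hδ0'
    -- If `c₄ = ωδ`, conjugating gives `c₄ = ω²δ`, impossible as `δ ≠ 0`.
    have hne : algebraMap K (AlgebraicClosure K) E.c₄ - ω * algebraMap K _ δ ≠ 0 := by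
      intro h0
      have h1 := congrArg σ h0
      rw [map_sub, map_mul, hσ, σ.commutes, σ.commutes, map_zero] at h1
      exact hωδ (by linear_combination h0 - h1)
    have hne' : algebraMap K (AlgebraicClosure K) E.c₄ - ω ^ 2 * algebraMap K _ δ ≠ 0 := by
      intro h0
      have h1 := congrArg σ h0
      rw [map_sub, map_mul, map_pow, hσ, hω4, σ.commutes, σ.commutes, map_zero] at h1
      exact hωδ (by linear_combination h1 - h0)
    have hb0 : b ≠ 0 := by rintro rfl; exact hne (by rw [← hb]; ring)
    have hc0 : c ≠ 0 := by rintro rfl; exact hne' (by rw [← hc]; ring)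
    -- Defining `a` by division fixes its sign so that `abc = c₆`, and allows `c₆ = 0`.
    have h : FerrariData E δ ω (algebraMap K _ E.c₆ / (b * c)) b c := by
      refine ⟨hω, ?_, hb, hc, by field_simp⟩
      rw [div_pow, mul_pow, hb, hc, div_eq_iff (mul_ne_zero hne hne'), ← map_pow, ← hrel]
      rw [omega_norm hω, map_mul, map_sub]
      simp only [map_mul, map_add, map_pow]
    have h2 := irreducible_map_iff hγ hK hω
    tfae_have 1 → 2 := by
      rintro ⟨e⟩
      rw [h2]
      exact fun l hl σ => apply_omega_of_card_eq_eight hγ (h.omega_mem_torsionField hγ)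
        ((Nat.card_congr e.toEquiv).trans (Nat.card_zmod 8)) hl
    tfae_have 2 → 3 := fun h1 => h.isSquare_of_free hK hb0 hc0 (h2.1 h1)
    tfae_have 3 → 1 := fun h3 => h.nonempty_mulEquiv hγ hK hδ0 hc0 h3.1 h3.2
    tfae_finish
  -- The two elements have nonzero square product, so a square root `r` of one gives `3c₆ / r` for
  -- the other.
  · have hprod : (-3 * (E.c₄ - δ)) * (-3 * (E.c₄ ^ 2 + E.c₄ * δ + δ ^ 2)) = (3 * E.c₆) ^ 2 := by
      linear_combination 9 * hrel
    have hne : (3 * E.c₆) ^ 2 ≠ 0 := by simpa using hc₆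
    rw [← hprod, mul_ne_zero_iff] at hne
    constructor
    · rintro ⟨r, hr⟩
      refine ⟨3 * E.c₆ / r, ?_⟩
      have hr0 : r ≠ 0 := by rintro rfl; exact hne.1 (by rw [hr, mul_zero])
      rw [hr] at hprod
      rw [← sq, div_pow, eq_div_iff (pow_ne_zero 2 hr0)]
      linear_combination hprod
    · rintro ⟨r, hr⟩
      refine ⟨3 * E.c₆ / r, ?_⟩
      have hr0 : r ≠ 0 := by rintro rfl; exact hne.2 (by rw [hr, mul_zero])
      rw [hr] at hprod
      rw [← sq, div_pow, eq_div_iff (pow_ne_zero 2 hr0)]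
      linear_combination hprod
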